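/- For $n\ge 0$ let $\mathrm{IP}_n:\{0,1\}^n\times\{0,1\}^n\to\{0,1\}$, $\mathrm{IP}_n(x,y)=\sum_{i=1}^n x_iy_i \bmod 2$, be the inner-product function. Then its deterministic $\gamma_2$ communication complexity, defined below, satisfies $$\mathsf{\Gamma_2D}^{\mathsf{cc}}(\mathrm{IP}_n)\;\ge\;\frac n2-1 .$$ Definitions. A *protocol structure* $\mathcal T$ is a finite rooted ordered binary tree in which every internal node has exactly two children and is either an Alice node or a Bob node. Nodes are named by binary strings: the root is the empty string $\lambda$, and the children of an internal node $t$ are $t0$ and $t1$. The depth of $\mathcal T$ is the maximal number of edges on a path from the root to a leaf. Let $\mathcal X,\mathcal Y$ be finite sets. A (deterministic) *$\gamma_2$ protocol* on $\mathcal X\times\mathcal Y$ with structure $\mathcal T$ consists of an integer $d\ge 0$ and maps $\alpha_t:\mathcal X\to\mathbb R^d$, $\beta_t:\mathcal Y\to\mathbb R^d$ for every node $t$ of $\mathcal T$, such that, for the standard inner product and the Euclidean norm, for all $x,x'\in\mathcal X$ and $y,y'\in\mathcal Y$: * at the root, $\langle\alpha_\lambda(x),\alpha_\lambda(x')\rangle=\langle\beta_\lambda(y),\beta_\lambda(y')\rangle=\langle\alpha_\lambda(x),\beta_\lambda(y)\rangle=1$;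 * at every Alice node $t$, $\|\alpha_{t0}(x)\|^2+\|\alpha_{t1}(x)\|^2=\|\alpha_t(x)\|^2$, $\langle\alpha_{t0}(x),\alpha_t(x)\rangle+\langle\alpha_{t1}(x),\alpha_t(x)\rangle=\|\alpha_t(x)\|^2$, $\langle\alpha_{t0}(x),\alpha_{t1}(x)\rangle=0$, and $\|\beta_{ti}(y)\|^2=\|\beta_t(y)\|^2=\langle\beta_{ti}(y),\beta_t(y)\rangle$ for $i\in\{0,1\}$; * at every Bob node $t$, the same constraints with the roles of $\alpha$ (and $x$) and $\beta$ (and $y$) exchanged. The protocol *computes* a function $f:\mathcal X\times\mathcal Y\to\{0,1\}$ if every leaf has depth at least $1$ and, for every leaf $\ell=tz$ with last bit $z\in\{0,1\}$ and all $(x,y)$ with $f(x,y)\ne z$, one has $\langle\alpha_\ell(x),\beta_\ell(y)\rangle=0$. Finally, $\mathsf{\Gamma_2D}^{\mathsf{cc}}(f)$ is the smallest depth of a protocol structure that carries a $\gamma_2$ protocol computing $f$. -/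

import Mathlib

namespace GammaTwo

/-- A two-player binary protocol structure: a finite rooted ordered binary tree in which every
internal node has exactly two children (the children `0` and `1`, in this order) and belongs
either to Alice or to Bob. -/
inductive ProtocolTree : Type
  | leaf : ProtocolTree
  | alice (t0 t1 : ProtocolTree) : ProtocolTree
  | bob (t0 t1 : ProtocolTree) : ProtocolTree

namespace ProtocolTree

/-- The depth of a tree: the number of edges of a longest path from the root to a leaf. -/
def depth : ProtocolTree → ℕ
  | leaf => 0
  | alice t0 t1 => max t0.depth t1.depth + 1
  | bob t0 t1 => max t0.depth t1.depth + 1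

/-- Nodes are named by the binary string that leads from the root to them (the root is `[]`, the
children of `t` are `t ++ [false]` and `t ++ [true]`). `T.subtreeAt t` is the subtree of `T` that
hangs at the node `t`, and `none` if the string `t` is not a node of `T`. -/
def subtreeAt : ProtocolTree → List Bool → Option ProtocolTree
  | T, [] => some T
  | leaf, _ :: _ => none
  | alice t0 t1, b :: s => (if b then t1 else t0).subtreeAt s
  | bob t0 t1, b :: s => (if b then t1 else t0).subtreeAt s

/-- `t` is a leaf of `T`. -/
def IsLeaf (T : ProtocolTree) (t : List Bool) : Prop :=
  T.subtreeAt t = some leaf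

/-- `t` is an internal node of `T` that belongs to Alice. -/
def IsAliceNode (T : ProtocolTree) (t : List Bool) : Prop :=
  ∃ t0 t1 : ProtocolTree, T.subtreeAt t = some (alice t0 t1)

/-- `t` is an internal node of `T` that belongs to Bob. -/
def IsBobNode (T : ProtocolTree) (t : List Bool) : Prop :=
  ∃ t0 t1 : ProtocolTree, T.subtreeAt t = some (bob t0 t1)

end ProtocolTree

/-- The constraints at a node for the vector `v` of the player who speaks there, where `v0`, `v1`
are the vectors at the two children. -/
structure SpeakerConstraints {d : ℕ} (v v0 v1 : EuclideanSpace ℝ (Fin d)) : Prop where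
  norm_sq_add : ‖v0‖ ^ 2 + ‖v1‖ ^ 2 = ‖v‖ ^ 2
  inner_add : inner ℝ v0 v + inner ℝ v1 v = ‖v‖ ^ 2
  orthogonal : inner ℝ v0 v1 = 0

/-- The constraints at a node for the vector `v` of the player who listens there, where `v0`, `v1`
are the vectors at the two children. -/
structure ListenerConstraints {d : ℕ} (v v0 v1 : EuclideanSpace ℝ (Fin d)) : Prop where
  norm_sq_zero : ‖v0‖ ^ 2 = ‖v‖ ^ 2
  norm_sq_one : ‖v1‖ ^ 2 = ‖v‖ ^ 2
  inner_zero : inner ℝ v0 v = ‖v‖ ^ 2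
  inner_one : inner ℝ v1 v = ‖v‖ ^ 2

/-- A deterministic `γ₂` protocol on the inputs `X × Y` with protocol structure `T`: vectors
`α t x` and `β t y` in `ℝᵈ` for every node `t` of `T`, subject to the root constraints and to the
node constraints. (The values of `α` and `β` at strings that are not nodes of `T` are
irrelevant: no constraint mentions them.) -/
structure Protocol (X Y : Type) [Finite X] [Finite Y] (T : ProtocolTree) where
  d : ℕ
  α : List Bool → X → EuclideanSpace ℝ (Fin d)
  β : List Bool → Y → EuclideanSpace ℝ (Fin d)
  root_alice : ∀ x x' : X, inner ℝ (α [] x) (α [] x') = 1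
  root_bob : ∀ y y' : Y, inner ℝ (β [] y) (β [] y') = 1
  root_mixed : ∀ (x : X) (y : Y), inner ℝ (α [] x) (β [] y) = 1
  alice_speaks : ∀ t : List Bool, T.IsAliceNode t →
    ∀ x : X, SpeakerConstraints (α t x) (α (t ++ [false]) x) (α (t ++ [true]) x)
  bob_listens : ∀ t : List Bool, T.IsAliceNode t →
    ∀ y : Y, ListenerConstraints (β t y) (β (t ++ [false]) y) (β (t ++ [true]) y)
  bob_speaks : ∀ t : List Bool, T.IsBobNode t →
    ∀ y : Y, SpeakerConstraints (β t y) (β (t ++ [false]) y) (β (t ++ [true]) y)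
  alice_listens : ∀ t : List Bool, T.IsBobNode t →
    ∀ x : X, ListenerConstraints (α t x) (α (t ++ [false]) x) (α (t ++ [true]) x)

/-- The protocol `π` computes the relation `f ⊆ X × Y × {0,1}ᵏ` (outputs are binary strings, of
which only those of length `k` matter): every leaf has depth at least `k`, and the last `k` bits
of the name of a leaf are its output. -/
def Protocol.Computes {X Y : Type} [Finite X] [Finite Y] {T : ProtocolTree}
    (π : Protocol X Y T) (k : ℕ) (f : X → Y → List Bool → Prop) : Prop :=
  (∀ l : List Bool, T.IsLeaf l → k ≤ l.length) ∧
  ∀ l t z : List Bool, T.IsLeaf l → l = t ++ z → z.length = k →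
    ∀ (x : X) (y : Y), ¬ f x y z → inner ℝ (π.α l x) (π.β l y) = 0

/-- The deterministic `γ₂` communication complexity of a relation `f ⊆ X × Y × {0,1}ᵏ`: the
smallest depth of a protocol structure that carries a `γ₂` protocol computing `f`. -/
noncomputable def complexity {X Y : Type} [Finite X] [Finite Y]
    (k : ℕ) (f : X → Y → List Bool → Prop) : ℕ :=
  sInf {m : ℕ | ∃ T : ProtocolTree, T.depth = m ∧ ∃ π : Protocol X Y T, π.Computes k f}

/-- A Boolean function, viewed as a relation whose outputs are strings of length one. -/
def graphRel {X Y : Type} (f : X → Y → Bool) : X → Y → List Bool → Prop :=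
  fun x y z => z = [f x y]

/-- The deterministic `γ₂` communication complexity `Γ₂Dᶜᶜ(f)` of a Boolean function. -/
noncomputable def gammaTwoD {X Y : Type} [Finite X] [Finite Y] (f : X → Y → Bool) : ℕ :=
  complexity 1 (graphRel f)

/-- The inner product modulo two: `IP n x y = x₁ y₁ + ⋯ + xₙ yₙ mod 2`. -/
def IP (n : ℕ) (x y : Fin n → Bool) : Bool :=
  decide ((∑ i : Fin n, (x i).toNat * (y i).toNat) % 2 = 1)

end GammaTwo

/-! The constraints are rigid: the listener's vector does not change, and the speaker's vector is
the orthogonal sum of its two children. Hence norms never exceed their root value 1, and `∑ x, ∑ y,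
⟪α t x, β t y⟫` at a node is the sum of its values at the children. At the root it is `4 ^ n`. At a
leaf with output `z` the inner product vanishes unless `IP n x y = z`, so up to a global sign the
sum may be weighted by `(-1) ^ IP n x y`; Lindsey's lemma bounds it by `√(8 ^ n)`. A tree of depth
`D` thus gives `4 ^ n ≤ 2 ^ D * √(8 ^ n)`, that is `n ≤ 2 * D`. The infimum of an empty set of
naturals is `0`, so a lower bound also requires that some protocol exists; the trivial one, in
dimension one, serves. -/

namespace GammaTwo

/-! ### Rigidity of the node constraints -/

section Constraints

variable {d : ℕ} {v v0 v1 : EuclideanSpace ℝ (Fin d)}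

lemma SpeakerConstraints.add_eq (h : SpeakerConstraints v v0 v1) : v0 + v1 = v := by
  have key : ‖(v0 + v1) - v‖ ^ 2 = 0 := by
    rw [norm_sub_sq_real, norm_add_sq_real, inner_add_left, h.inner_add, h.orthogonal,
      ← h.norm_sq_add]
    ring
  exact sub_eq_zero.mp (norm_eq_zero.mp (pow_eq_zero_iff two_ne_zero |>.mp key))

lemma SpeakerConstraints.norm_zero_le (h : SpeakerConstraints v v0 v1) : ‖v0‖ ≤ ‖v‖ := by
  refine le_of_sq_le_sq ?_ (norm_nonneg _)
  rw [← h.norm_sq_add]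
  exact le_add_of_nonneg_right (sq_nonneg _)

lemma SpeakerConstraints.norm_one_le (h : SpeakerConstraints v v0 v1) : ‖v1‖ ≤ ‖v‖ := by
  refine le_of_sq_le_sq ?_ (norm_nonneg _)
  rw [← h.norm_sq_add]
  exact le_add_of_nonneg_left (sq_nonneg _)

/-- The equality case of Cauchy–Schwarz: expanding `‖v0 - v‖ ^ 2` gives zero. -/
lemma eq_of_norm_sq_eq_of_inner_eq (hn : ‖v0‖ ^ 2 = ‖v‖ ^ 2) (hi : inner ℝ v0 v = ‖v‖ ^ 2) :
    v0 = v := by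
  have key : ‖v0 - v‖ ^ 2 = 0 := by
    rw [norm_sub_sq_real, hi, hn]
    ring
  exact sub_eq_zero.mp (norm_eq_zero.mp (pow_eq_zero_iff two_ne_zero |>.mp key))

lemma ListenerConstraints.zero_eq (h : ListenerConstraints v v0 v1) : v0 = v :=
  eq_of_norm_sq_eq_of_inner_eq h.norm_sq_zero h.inner_zero

lemma ListenerConstraints.one_eq (h : ListenerConstraints v v0 v1) : v1 = v :=
  eq_of_norm_sq_eq_of_inner_eq h.norm_sq_one h.inner_one

lemma ListenerConstraints.refl (v : EuclideanSpace ℝ (Fin d)) : ListenerConstraints v v v :=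
  ⟨rfl, rfl, real_inner_self_eq_norm_sq v, real_inner_self_eq_norm_sq v⟩

lemma SpeakerConstraints.self_zero (v : EuclideanSpace ℝ (Fin d)) :
    SpeakerConstraints v v 0 :=
  ⟨by simp, by simp, by simp⟩

lemma SpeakerConstraints.zero_self (v : EuclideanSpace ℝ (Fin d)) :
    SpeakerConstraints v 0 v :=
  ⟨by simp, by simp, by simp⟩

end Constraints

lemma ProtocolTree.subtreeAt_append (T : ProtocolTree) (s t : List Bool) :
    T.subtreeAt (s ++ t) = (T.subtreeAt s).bind fun S => S.subtreeAt t := by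
  induction s generalizing T with
  | nil => cases T <;> simp [subtreeAt]
  | cons b s ih => cases T <;> simp [subtreeAt, ih]

/-! ### Lindsey's lemma -/

section Lindsey

/-- The sign `(-1) ^ b` of a bit `b`. -/
def bitSign (b : Bool) : ℝ := if b then -1 else 1

lemma bitSign_mul_self (b : Bool) : bitSign b * bitSign b = 1 := by
  cases b <;> norm_num [bitSign]

lemma abs_bitSign (b : Bool) : |bitSign b| = 1 := by
  cases b <;> norm_num [bitSign]

lemma bitSign_decide_mod_two (m : ℕ) : bitSign (decide (m % 2 = 1)) = (-1) ^ m := by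
  rcases Nat.mod_two_eq_zero_or_one m with h | h
  · simp [bitSign, h, (Nat.even_iff.mpr h).neg_one_pow]
  · simp [bitSign, h, (Nat.odd_iff.mpr h).neg_one_pow]

lemma bitSign_IP (n : ℕ) (x y : Fin n → Bool) :
    bitSign (IP n x y) = ∏ i, (-1 : ℝ) ^ ((x i).toNat * (y i).toNat) := by
  rw [IP, bitSign_decide_mod_two, Finset.prod_pow_eq_pow_sum]

/-- The sum factors over coordinates; where `y` and `y'` differ, the factor is `1 - 1 = 0`. -/
lemma sum_bitSign_IP_mul (n : ℕ) (y y' : Fin n → Bool) :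
    ∑ x, bitSign (IP n x y) * bitSign (IP n x y') = if y = y' then (2 : ℝ) ^ n else 0 := by
  simp_rw [bitSign_IP, ← Finset.prod_mul_distrib]
  rw [← Fintype.prod_sum fun i (b : Bool) =>
    (-1 : ℝ) ^ (b.toNat * (y i).toNat) * (-1) ^ (b.toNat * (y' i).toNat)]
  split_ifs with h
  · subst h
    have (i : Fin n) : ∑ b : Bool, (-1 : ℝ) ^ (b.toNat * (y i).toNat) *
        (-1) ^ (b.toNat * (y i).toNat) = 2 := by
      cases y i <;> norm_num
    rw [Finset.prod_congr rfl fun i _ => this i]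
    simp
  · obtain ⟨i, hi⟩ := Function.ne_iff.mp h
    refine Finset.prod_eq_zero (Finset.mem_univ i) ?_
    revert hi
    cases y i <;> cases y' i <;> norm_num

variable {E : Type*} [NormedAddCommGroup E] [InnerProductSpace ℝ E]

/-- Parseval for the sign matrix, whose columns are orthogonal of squared norm `2 ^ n`. -/
lemma sum_norm_sq_sum_bitSign_smul (n : ℕ) (b : (Fin n → Bool) → E) :
    ∑ x, ‖∑ y, bitSign (IP n x y) • b y‖ ^ 2 = 2 ^ n * ∑ y, ‖b y‖ ^ 2 := by
  calc ∑ x, ‖∑ y, bitSign (IP n x y) • b y‖ ^ 2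
      = ∑ x, ∑ y, ∑ y', bitSign (IP n x y) * bitSign (IP n x y') * inner ℝ (b y) (b y') := by
        refine Finset.sum_congr rfl fun x _ => ?_
        rw [← real_inner_self_eq_norm_sq, sum_inner]
        refine Finset.sum_congr rfl fun y _ => ?_
        rw [inner_sum]
        refine Finset.sum_congr rfl fun y' _ => ?_
        rw [real_inner_smul_left, real_inner_smul_right, mul_assoc]
    _ = ∑ y, ∑ y', (∑ x, bitSign (IP n x y) * bitSign (IP n x y')) * inner ℝ (b y) (b y') := by
        rw [Finset.sum_comm]
        refine Finset.sum_congr rfl fun y _ => ?_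
        rw [Finset.sum_comm]
        simp_rw [Finset.sum_mul]
    _ = 2 ^ n * ∑ y, ‖b y‖ ^ 2 := by
        simp_rw [sum_bitSign_IP_mul, ite_mul, zero_mul, Finset.sum_ite_eq, Finset.mem_univ,
          if_true, real_inner_self_eq_norm_sq, Finset.mul_sum]

/-- **Lindsey's lemma** for the inner-product matrix and vectors of norm at most one. -/
lemma abs_sum_bitSign_IP_mul_inner_le (n : ℕ) (a b : (Fin n → Bool) → E)
    (ha : ∀ x, ‖a x‖ ≤ 1) (hb : ∀ y, ‖b y‖ ≤ 1) :
    |∑ x, ∑ y, bitSign (IP n x y) * inner ℝ (a x) (b y)| ≤ √(8 ^ n) := by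
  have hsum (c : (Fin n → Bool) → E) (hc : ∀ x, ‖c x‖ ≤ 1) : ∑ x, ‖c x‖ ^ 2 ≤ (2 : ℝ) ^ n := by
    calc ∑ x, ‖c x‖ ^ 2 ≤ ∑ _x : Fin n → Bool, (1 : ℝ) :=
          Finset.sum_le_sum fun x _ => pow_le_one₀ (norm_nonneg _) (hc x)
      _ = 2 ^ n := by simp
  have hrow : |∑ x, ∑ y, bitSign (IP n x y) * inner ℝ (a x) (b y)| ≤
      ∑ x, ‖a x‖ * ‖∑ y, bitSign (IP n x y) • b y‖ := by
    refine (Finset.abs_sum_le_sum_abs _ _).trans (Finset.sum_le_sum fun x _ => ?_)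
    simp_rw [← real_inner_smul_right, ← inner_sum]
    exact abs_real_inner_le_norm _ _
  refine hrow.trans (Real.le_sqrt_of_sq_le ?_)
  -- A second Cauchy–Schwarz, now over the rows, makes Parseval applicable.
  refine (Finset.sum_mul_sq_le_sq_mul_sq _ _ _).trans ?_
  rw [sum_norm_sq_sum_bitSign_smul]
  calc (∑ x, ‖a x‖ ^ 2) * (2 ^ n * ∑ y, ‖b y‖ ^ 2) ≤ 2 ^ n * (2 ^ n * 2 ^ n) := by
        gcongr
        · exact hsum a ha
        · exact hsum b hb
    _ = (8 : ℝ) ^ n := by rw [← mul_pow, ← mul_pow]; norm_num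

end Lindsey

/-! ### The lower bound for an arbitrary protocol -/

section LowerBound

variable {n : ℕ} {T : ProtocolTree} {π : Protocol (Fin n → Bool) (Fin n → Bool) T}

lemma Protocol.Computes.abs_sum_inner_le_of_isLeaf (hπ : π.Computes 1 (graphRel (IP n)))
    {l : List Bool} (hl : T.IsLeaf l) (hα : ∀ x, ‖π.α l x‖ ≤ 1) (hβ : ∀ y, ‖π.β l y‖ ≤ 1) :
    |∑ x, ∑ y, inner ℝ (π.α l x) (π.β l y)| ≤ √(8 ^ n) := by
  have hne : l ≠ [] := List.ne_nil_of_length_pos (hπ.1 l hl)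
  have hzero := hπ.2 l l.dropLast [l.getLast hne] hl (List.dropLast_append_getLast hne).symm rfl
  -- On the support of the inner product the two signs agree and cancel; elsewhere both sides are
  -- zero.
  have hsign (x y : Fin n → Bool) : inner ℝ (π.α l x) (π.β l y) =
      bitSign (l.getLast hne) * (bitSign (IP n x y) * inner ℝ (π.α l x) (π.β l y)) := by
    by_cases hxy : l.getLast hne = IP n x y
    · rw [hxy, ← mul_assoc, bitSign_mul_self, one_mul]
    · rw [hzero x y (by simpa [graphRel] using hxy)]
      simp
  rw [Finset.sum_congr rfl fun x _ => Finset.sum_congr rfl fun y _ => hsign x y]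
  simp_rw [← Finset.mul_sum]
  rw [abs_mul, abs_bitSign, one_mul]
  exact abs_sum_bitSign_IP_mul_inner_le n _ _ hα hβ

lemma abs_le_of_eq_add_of_le {s s0 s1 C : ℝ} {d0 d1 : ℕ} (hC : 0 ≤ C) (h : s = s0 + s1)
    (h0 : |s0| ≤ 2 ^ d0 * C) (h1 : |s1| ≤ 2 ^ d1 * C) : |s| ≤ 2 ^ (max d0 d1 + 1) * C := by
  have e0 : (2 : ℝ) ^ d0 * C ≤ 2 ^ max d0 d1 * C := by
    gcongr
    · norm_num
    · exact le_max_left _ _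
  have e1 : (2 : ℝ) ^ d1 * C ≤ 2 ^ max d0 d1 * C := by
    gcongr
    · norm_num
    · exact le_max_right _ _
  rw [h, pow_succ]
  linarith [abs_add_le s0 s1]

lemma Protocol.Computes.abs_sum_inner_le (hπ : π.Computes 1 (graphRel (IP n)))
    (S : ProtocolTree) (t : List Bool) (ht : T.subtreeAt t = some S)
    (hα : ∀ x, ‖π.α t x‖ ≤ 1) (hβ : ∀ y, ‖π.β t y‖ ≤ 1) :
    |∑ x, ∑ y, inner ℝ (π.α t x) (π.β t y)| ≤ 2 ^ S.depth * √(8 ^ n) := by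
  induction S generalizing t with
  | leaf => simpa [ProtocolTree.depth] using hπ.abs_sum_inner_le_of_isLeaf ht hα hβ
  | alice t0 t1 ih0 ih1 =>
    have hs := π.alice_speaks t ⟨t0, t1, ht⟩
    have hl := π.bob_listens t ⟨t0, t1, ht⟩
    refine abs_le_of_eq_add_of_le (Real.sqrt_nonneg _) ?_
      (ih0 (t ++ [false]) (by simp [ProtocolTree.subtreeAt_append, ht, ProtocolTree.subtreeAt])
        (fun x => (hs x).norm_zero_le.trans (hα x)) fun y => by rw [(hl y).zero_eq]; exact hβ y)
      (ih1 (t ++ [true]) (by simp [ProtocolTree.subtreeAt_append, ht, ProtocolTree.subtreeAt])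
        (fun x => (hs x).norm_one_le.trans (hα x)) fun y => by rw [(hl y).one_eq]; exact hβ y)
    simp_rw [← Finset.sum_add_distrib]
    refine Finset.sum_congr rfl fun x _ => Finset.sum_congr rfl fun y _ => ?_
    rw [(hl y).zero_eq, (hl y).one_eq, ← inner_add_left, (hs x).add_eq]
  | bob t0 t1 ih0 ih1 =>
    have hs := π.bob_speaks t ⟨t0, t1, ht⟩
    have hl := π.alice_listens t ⟨t0, t1, ht⟩
    refine abs_le_of_eq_add_of_le (Real.sqrt_nonneg _) ?_
      (ih0 (t ++ [false]) (by simp [ProtocolTree.subtreeAt_append, ht, ProtocolTree.subtreeAt])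
        (fun x => by rw [(hl x).zero_eq]; exact hα x) fun y => (hs y).norm_zero_le.trans (hβ y))
      (ih1 (t ++ [true]) (by simp [ProtocolTree.subtreeAt_append, ht, ProtocolTree.subtreeAt])
        (fun x => by rw [(hl x).one_eq]; exact hα x) fun y => (hs y).norm_one_le.trans (hβ y))
    simp_rw [← Finset.sum_add_distrib]
    refine Finset.sum_congr rfl fun x _ => Finset.sum_congr rfl fun y _ => ?_
    rw [(hl x).zero_eq, (hl x).one_eq, ← inner_add_right, (hs y).add_eq]

lemma Protocol.Computes.le_two_mul_depth (hπ : π.Computes 1 (graphRel (IP n))) :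
    n ≤ 2 * T.depth := by
  have hα (x : Fin n → Bool) : ‖π.α [] x‖ ≤ 1 := by
    rw [← sq_le_one_iff₀ (norm_nonneg _), ← real_inner_self_eq_norm_sq, π.root_alice]
  have hβ (y : Fin n → Bool) : ‖π.β [] y‖ ≤ 1 := by
    rw [← sq_le_one_iff₀ (norm_nonneg _), ← real_inner_self_eq_norm_sq, π.root_bob]
  have key := hπ.abs_sum_inner_le T [] (by cases T <;> rfl) hα hβ
  simp only [π.root_mixed, Finset.sum_const, Finset.card_univ, Fintype.card_pi,
    Fintype.card_bool, Finset.prod_const, Fintype.card_fin, nsmul_eq_mul, mul_one,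
    Nat.cast_pow, Nat.cast_ofNat] at key
  -- Squaring removes the root and leaves a comparison of integer powers of two.
  have hsq := pow_le_pow_left₀ (abs_nonneg _) key 2
  rw [sq_abs, mul_pow _ (√_), Real.sq_sqrt (by positivity)] at hsq
  have h16 : ((2 : ℝ) ^ n * 2 ^ n) ^ 2 = 2 ^ n * 8 ^ n := by
    rw [← mul_pow, ← mul_pow, ← pow_mul, mul_comm n 2, pow_mul]
    norm_num
  rw [h16, ← pow_mul, mul_comm T.depth 2] at hsq
  exact (pow_le_pow_iff_right₀ one_lt_two).mp (le_of_mul_le_mul_right hsq (by positivity))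

end LowerBound

/-! ### A protocol exists for every function -/

section TrivialProtocol

/-- The structure of the protocol in which Alice sends `n` bits and then Bob sends one bit. -/
def ProtocolTree.sendInput : ℕ → ProtocolTree
  | 0 => bob leaf leaf
  | n + 1 => alice (sendInput n) (sendInput n)

namespace ProtocolTree

lemma IsAliceNode.length_lt_of_sendInput {n : ℕ} {t : List Bool}
    (h : (sendInput n).IsAliceNode t) : t.length < n := by
  induction n generalizing t with
  | zero =>
    obtain ⟨t0, t1, h⟩ := h
    match t, h with
    | [], h => simp [sendInput, subtreeAt] at h
    | [b], h => cases b <;> simp [sendInput, subtreeAt] at h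
    | b :: c :: s, h => cases b <;> simp [sendInput, subtreeAt] at h
  | succ n ih =>
    obtain ⟨t0, t1, h⟩ := h
    match t, h with
    | [], h => simp
    | b :: s, h =>
      have := ih ⟨t0, t1, by simpa [sendInput, subtreeAt] using h⟩
      simpa using this

lemma IsBobNode.length_eq_of_sendInput {n : ℕ} {t : List Bool}
    (h : (sendInput n).IsBobNode t) : t.length = n := by
  induction n generalizing t with
  | zero =>
    obtain ⟨t0, t1, h⟩ := h
    match t, h with
    | [], h => rfl
    | [b], h => cases b <;> simp [sendInput, subtreeAt] at h
    | b :: c :: s, h => cases b <;> simp [sendInput, subtreeAt] at h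
  | succ n ih =>
    obtain ⟨t0, t1, h⟩ := h
    match t, h with
    | [], h => simp [sendInput, subtreeAt] at h
    | b :: s, h =>
      have := ih ⟨t0, t1, by simpa [sendInput, subtreeAt] using h⟩
      simpa using this

lemma IsLeaf.length_eq_of_sendInput {n : ℕ} {t : List Bool}
    (h : (sendInput n).IsLeaf t) : t.length = n + 1 := by
  induction n generalizing t with
  | zero =>
    rw [IsLeaf] at h
    match t, h with
    | [], h => simp [sendInput, subtreeAt] at h
    | [b], h => rfl
    | b :: c :: s, h => cases b <;> simp [sendInput, subtreeAt] at h
  | succ n ih =>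
    rw [IsLeaf] at h
    match t, h with
    | [], h => simp [sendInput, subtreeAt] at h
    | b :: s, h =>
      have := ih (t := s) (by simpa [IsLeaf, sendInput, subtreeAt] using h)
      simpa using this

end ProtocolTree

/-- The bits of `t` at positions below `n` agree with those of `x`. -/
def AgreesWith {n : ℕ} (t : List Bool) (x : Fin n → Bool) : Prop :=
  ∀ i : Fin n, ∀ b : Bool, t[i.val]? = some b → b = x i

lemma agreesWith_append_of_le {n : ℕ} {t : List Bool} (x : Fin n → Bool) (b : Bool)
    (h : n ≤ t.length) : AgreesWith (t ++ [b]) x ↔ AgreesWith t x := by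
  refine forall_congr' fun i => ?_
  rw [List.getElem?_append_left (i.isLt.trans_le h)]

lemma agreesWith_append_of_lt {n : ℕ} {t : List Bool} (x : Fin n → Bool) (b : Bool)
    (h : t.length < n) : AgreesWith (t ++ [b]) x ↔ AgreesWith t x ∧ b = x ⟨t.length, h⟩ := by
  constructor
  · refine fun H => ⟨fun i c hc => H i c ?_, H ⟨t.length, h⟩ b (by simp)⟩
    rw [List.getElem?_append_left (List.getElem?_eq_some_iff.mp hc).1, hc]
  · rintro ⟨H, hb⟩ i c hc
    rcases lt_trichotomy i.val t.length with hi | hi | hi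
    · rw [List.getElem?_append_left hi] at hc
      exact H i c hc
    · have : i = ⟨t.length, h⟩ := Fin.ext hi
      subst this
      simp only [List.getElem?_concat_length, Option.some.injEq] at hc
      rw [← hc, hb]
    · rw [List.getElem?_eq_none (by simpa using hi)] at hc
      cases hc

/-- The vector `1` of `ℝ¹` if `p` holds, and `0` otherwise. -/
noncomputable def indicatorVec (p : Prop) : EuclideanSpace ℝ (Fin 1) :=
  open Classical in if p then EuclideanSpace.single 0 1 else 0

lemma indicatorVec_of {p : Prop} (h : p) : indicatorVec p = EuclideanSpace.single 0 1 := if_pos h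

lemma indicatorVec_of_not {p : Prop} (h : ¬ p) : indicatorVec p = 0 := if_neg h

/-- Here `c` is the bit that an honest speaker sends: that child inherits the vector and the other
gets `0`. -/
lemma speakerConstraints_indicatorVec {p p0 p1 : Prop} (c : Bool)
    (h0 : p0 ↔ p ∧ false = c) (h1 : p1 ↔ p ∧ true = c) :
    SpeakerConstraints (indicatorVec p) (indicatorVec p0) (indicatorVec p1) := by
  rw [h0, h1]
  cases c
  · simpa [indicatorVec_of_not] using SpeakerConstraints.self_zero (indicatorVec p)
  · simpa [indicatorVec_of_not] using SpeakerConstraints.zero_self (indicatorVec p)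

/-- The bit of `t` at position `n`, if present, is the value of `f` at the first `n` bits of `t`
and `y`. -/
def AnswersWith {n : ℕ} {Y : Type} (f : (Fin n → Bool) → Y → Bool) (t : List Bool) (y : Y) :
    Prop :=
  ∀ b : Bool, t[n]? = some b → b = f (fun i => t.getD i false) y

lemma answersWith_of_le {n : ℕ} {Y : Type} (f : (Fin n → Bool) → Y → Bool) {t : List Bool} (y : Y)
    (h : t.length ≤ n) : AnswersWith f t y := by
  intro b hb
  rw [List.getElem?_eq_none h] at hb
  cases hb

lemma answersWith_append_of_eq {n : ℕ} {Y : Type} (f : (Fin n → Bool) → Y → Bool) {t : List Bool}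
    (y : Y) (b : Bool) (h : t.length = n) :
    AnswersWith f (t ++ [b]) y ↔ b = f (fun i => t.getD i false) y := by
  have hbits : (fun i : Fin n => (t ++ [b]).getD i false) = fun i : Fin n => t.getD i false := by
    funext i
    rw [List.getD_append _ _ _ _ (h ▸ i.isLt)]
  have hlast : (t ++ [b])[n]? = some b := by rw [← h]; simp
  rw [AnswersWith, hbits, hlast]
  simp

/-- The protocol in which Alice sends her input and then Bob sends the value of `f`. -/
noncomputable def sendInputProtocol {n : ℕ} {Y : Type} [Finite Y]
    (f : (Fin n → Bool) → Y → Bool) :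
    Protocol (Fin n → Bool) Y (ProtocolTree.sendInput n) where
  d := 1
  α t x := indicatorVec (AgreesWith t x)
  β t y := indicatorVec (AnswersWith f t y)
  root_alice x x' := by
    rw [indicatorVec_of (by simp [AgreesWith]), indicatorVec_of (by simp [AgreesWith])]
    simp
  root_bob y y' := by
    rw [indicatorVec_of (by simp [AnswersWith]), indicatorVec_of (by simp [AnswersWith])]
    simp
  root_mixed x y := by
    rw [indicatorVec_of (by simp [AgreesWith]), indicatorVec_of (by simp [AnswersWith])]
    simp
  alice_speaks t ht x :=
    speakerConstraints_indicatorVec (x ⟨t.length, ht.length_lt_of_sendInput⟩)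
      (agreesWith_append_of_lt x _ _) (agreesWith_append_of_lt x _ _)
  bob_listens t ht y := by
    have hlt := ht.length_lt_of_sendInput
    rw [indicatorVec_of (answersWith_of_le f y hlt.le),
      indicatorVec_of (answersWith_of_le f y (by simpa using hlt)),
      indicatorVec_of (answersWith_of_le f y (by simpa using hlt))]
    exact ListenerConstraints.refl _
  bob_speaks t ht y := by
    have hlen := ht.length_eq_of_sendInput
    have htrue : AnswersWith f t y := answersWith_of_le f y hlen.le
    exact speakerConstraints_indicatorVec (f (fun i => t.getD i false) y)
      (by simp only [answersWith_append_of_eq f y _ hlen, htrue, true_and])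
      (by simp only [answersWith_append_of_eq f y _ hlen, htrue, true_and])
  alice_listens t ht x := by
    have hlen := ht.length_eq_of_sendInput
    rw [agreesWith_append_of_le x _ hlen.ge, agreesWith_append_of_le x _ hlen.ge]
    exact ListenerConstraints.refl _

lemma sendInputProtocol_computes {n : ℕ} {Y : Type} [Finite Y] (f : (Fin n → Bool) → Y → Bool) :
    (sendInputProtocol f).Computes 1 (graphRel f) := by
  refine ⟨fun l hl => by rw [hl.length_eq_of_sendInput]; omega, ?_⟩
  rintro l t z hl rfl hz x y hxy
  obtain ⟨b, rfl⟩ := List.length_eq_one_iff.mp hz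
  have hlen : t.length = n := by simpa using hl.length_eq_of_sendInput
  change inner ℝ (indicatorVec (AgreesWith (t ++ [b]) x))
    (indicatorVec (AnswersWith f (t ++ [b]) y)) = 0
  rw [agreesWith_append_of_le x b hlen.ge, answersWith_append_of_eq f y b hlen]
  by_cases ha : AgreesWith t x
  · have hx : (fun i : Fin n => t.getD i false) = x := by
      funext i
      have hi : i.val < t.length := hlen ▸ i.isLt
      rw [← ha i t[i.val] (List.getElem?_eq_getElem hi)]
      exact List.getD_eq_getElem _ _ hi
    rw [hx, indicatorVec_of_not (p := b = f x y) (by simpa [graphRel] using hxy), inner_zero_right]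
  · rw [indicatorVec_of_not ha, inner_zero_left]

end TrivialProtocol

lemma exists_computes_depth_eq_gammaTwoD {n : ℕ} {Y : Type} [Finite Y]
    (f : (Fin n → Bool) → Y → Bool) :
    ∃ T : ProtocolTree, T.depth = gammaTwoD f ∧
      ∃ π : Protocol (Fin n → Bool) Y T, π.Computes 1 (graphRel f) :=
  Nat.sInf_mem (s := {m : ℕ | ∃ T : ProtocolTree, T.depth = m ∧
      ∃ π : Protocol (Fin n → Bool) Y T, π.Computes 1 (graphRel f)})
    ⟨_, _, rfl, sendInputProtocol f, sendInputProtocol_computes f⟩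

end GammaTwo

theorem mainTheorem12 (n : ℕ) :
    (n : ℝ) / 2 - 1 ≤ (GammaTwo.gammaTwoD (GammaTwo.IP n) : ℝ) := by
  obtain ⟨T, hT, π, hπ⟩ := GammaTwo.exists_computes_depth_eq_gammaTwoD (GammaTwo.IP n)
  have h : (n : ℝ) ≤ 2 * T.depth := by exact_mod_cast hπ.le_two_mul_depth
  rw [← hT]
  linarith
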